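/- Let $q=2^m$ with $m\ge 1$, let $\Bbbk$ be an algebraic closure of $\mathbb{F}_q$, and let $\mathbb{G}=\mathbf{Sp}_4(\Bbbk)$ be the subgroup of $\mathbf{GL}_4(\Bbbk)$ leaving invariant the bilinear form with matrix $\begin{pmatrix}0&J\\-J&0\end{pmatrix}$, where $J=\begin{pmatrix}0&1\\1&0\end{pmatrix}$. Let $F$ be the endomorphism of $\mathbb{G}$ raising all matrix entries to the $q$-th power, and let $G=\mathbf{Sp}_4(q)=\mathbb{G}^F$. An element $u\in\mathbb{G}$ is said to be of type $W(2)$ if it is conjugate in $\mathbb{G}$ to $\operatorname{diag}(X, J\,{}^tX^{-1}J)$ for some regular unipotent $X\in\mathbf{SL}_2(\Bbbk)$ (that is, $X$ is unipotent with a single Jordan block). For $u\in G$ let $\mathcal{C}(G,u)$ be the set of $G$-conjugacy classes contained in the $\mathbb{G}$-conjugacy class of $u$. A conjugacy class is regarded as a rack with $x\triangleright y=xyx^{-1}$. A subrack of a rack $X$ is a non-empty subset $Y$ such that $y\triangleright\_$ restricts to a bijection of $Y$ for all $y\in Y$. A rack $X$ is of type D if it has disjoint subracks $R,S$ whose union is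 a subrack, and elements $r\in R$, $s\in S$ such that $r\triangleright(s\triangleright(r\triangleright s))\neq s$. It is of type F if it has mutually disjoint subracks $R_1,\dots,R_4$ and elements $r_a\in R_a$ such that $R_a\triangleright R_b=R_b$ for all $a,b$, and $r_a\triangleright r_b\ne r_b$ for all $a\neq b$. It is cthulhu if it is neither of type D nor of type F. **Lemma 4.26.** The elements of $G$ of type $W(2)$ form a single $G$-conjugacy class $\mathcal{O}$; for every $u\in G$ of type $W(2)$ one has $\mathcal{C}(G,u)=\{\mathcal{O}\}$; and $\mathcal{O}$ is cthulhu. -/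

import Mathlib

open scoped Quandles Matrix

/-! ### Racks -/

section Racks

universe v

variable {X : Type v} [Rack X]

/-- A subrack of a rack `X`: a non-empty subset `Y` such that `y ◃ _` restricts to a bijection
of `Y` for every `y ∈ Y` (injectivity is automatic). -/
def IsSubrack (Y : Set X) : Prop :=
  Y.Nonempty ∧ ∀ y ∈ Y, (fun z => y ◃ z) '' Y = Y

/-- `X` is of type D: there are a decomposable subrack `Y = R ∐ S` (a disjoint union of two
subracks) and elements `r ∈ R`, `s ∈ S` with `r ◃ (s ◃ (r ◃ s)) ≠ s`. -/
def IsTypeD (X : Type v) [Rack X] : Prop :=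
  ∃ R S : Set X, IsSubrack R ∧ IsSubrack S ∧ Disjoint R S ∧ IsSubrack (R ∪ S) ∧
    ∃ r ∈ R, ∃ s ∈ S, r ◃ (s ◃ (r ◃ s)) ≠ s

/-- `X` is of type F: there are four mutually disjoint subracks `R a` with `R a ◃ R b = R b` for
all `a, b`, and elements `r a ∈ R a` with `r a ◃ r b ≠ r b` whenever `a ≠ b`. -/
def IsTypeF (X : Type v) [Rack X] : Prop :=
  ∃ (R : Fin 4 → Set X) (r : Fin 4 → X),
    (∀ a, IsSubrack (R a)) ∧
    (∀ a b, a ≠ b → Disjoint (R a) (R b)) ∧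
    (∀ a b, Set.image2 (fun x y => x ◃ y) (R a) (R b) = R b) ∧
    (∀ a, r a ∈ R a) ∧
    (∀ a b, a ≠ b → r a ◃ r b ≠ r b)

/-- `X` is cthulhu if it is neither of type D nor of type F. -/
def IsCthulhu (X : Type v) [Rack X] : Prop :=
  ¬ IsTypeD X ∧ ¬ IsTypeF X

end Racks

/-! ### Conjugacy classes -/

section Conjugacy

variable {H : Type*} [Group H]

theorem conj_mem_carrier (C : ConjClasses H) (x : H) {y : H} (hy : y ∈ C.carrier) :
    x * y * x⁻¹ ∈ C.carrier := by
  rw [ConjClasses.mem_carrier_iff_mk_eq] at hy ⊢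
  rw [← hy, ConjClasses.mk_eq_mk_iff_isConj]
  exact (isConj_iff.mpr ⟨x, rfl⟩).symm

/-- A conjugacy class of a group is a rack for `x ◃ y = x * y * x⁻¹`. -/
instance conjClassRack (C : ConjClasses H) : Rack C.carrier where
  act x y := ⟨x * y * (x : H)⁻¹, conj_mem_carrier C x y.2⟩
  self_distrib := by
    intro x y z
    apply Subtype.ext
    simp [mul_assoc]
  invAct x y := ⟨(x : H)⁻¹ * y * (x : H), by
    simpa using conj_mem_carrier C (x : H)⁻¹ y.2⟩
  left_inv x y := by
    apply Subtype.ext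
    simp [mul_assoc]
  right_inv x y := by
    apply Subtype.ext
    simp [mul_assoc]

/-- `𝒞(N, x)`: the set of the `N`-conjugacy classes that are contained in the
`H`-conjugacy class of `x`. -/
def classesWithin (N : Subgroup H) (x : H) : Set (ConjClasses N) :=
  {C | ∀ y ∈ C.carrier, IsConj x (y : H)}

end Conjugacy

/-! ### Symplectic groups -/

section Symplectic

variable (m : ℕ) (k : Type*) [Field k]

/-- The `m × m` matrix with ones on the antidiagonal and zeros elsewhere. -/
def antiJ : Matrix (Fin m) (Fin m) k :=
  Matrix.of fun i j => if j = Fin.rev i then 1 else 0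

theorem antiJ_mul_self : antiJ m k * antiJ m k = 1 := by
  ext i j
  have h : ∀ l : Fin m, (if j = Fin.rev l then (if l = Fin.rev i then (1 : k) else 0) else 0)
      = if l = Fin.rev i then (if i = j then 1 else 0) else 0 := by
    intro l
    by_cases hl : l = Fin.rev i
    · subst hl
      simp [eq_comm]
    · simp [hl]
  simp [antiJ, Matrix.mul_apply, Matrix.one_apply, h]

theorem antiJ_transpose : (antiJ m k)ᵀ = antiJ m k := by
  ext i j
  have h : (i = Fin.rev j) = (j = Fin.rev i) :=
    propext ⟨fun e => by simp [e], fun e => by simp [e]⟩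
  simp [antiJ, h]

/-- The matrix of the standard symplectic form on `k ^ (2m)`. -/
def sympForm : Matrix (Fin m ⊕ Fin m) (Fin m ⊕ Fin m) k :=
  Matrix.fromBlocks 0 (antiJ m k) (-antiJ m k) 0

/-- The symplectic group `Sp_{2m}(k)`: the invertible matrices of size `2m` (written in
`m × m` blocks) that leave the bilinear form `sympForm` invariant. -/
def Sp : Subgroup (GL (Fin m ⊕ Fin m) k) where
  carrier := {g | (g.val)ᵀ * sympForm m k * g.val = sympForm m k}
  one_mem' := by simp
  mul_mem' := by
    intro a b ha hb
    simp only [Set.mem_ofPred_eq, Units.val_mul, Matrix.transpose_mul] at *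
    calc (b.val)ᵀ * (a.val)ᵀ * sympForm m k * (a.val * b.val)
        = (b.val)ᵀ * ((a.val)ᵀ * sympForm m k * a.val) * b.val := by
          simp only [Matrix.mul_assoc]
      _ = _ := by rw [ha, hb]
  inv_mem' := by
    intro a ha
    simp only [Set.mem_ofPred_eq] at *
    have h1 : a.val * (a⁻¹).val = 1 := a.mul_inv
    have h2 : ((a⁻¹).val)ᵀ * (a.val)ᵀ = 1 := by
      rw [← Matrix.transpose_mul, h1, Matrix.transpose_one]
    calc ((a⁻¹).val)ᵀ * sympForm m k * (a⁻¹).val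
        = ((a⁻¹).val)ᵀ * ((a.val)ᵀ * sympForm m k * a.val) * (a⁻¹).val := by rw [ha]
      _ = (((a⁻¹).val)ᵀ * (a.val)ᵀ) * sympForm m k * (a.val * (a⁻¹).val) := by
          simp only [Matrix.mul_assoc]
      _ = sympForm m k := by rw [h1, h2, Matrix.one_mul, Matrix.mul_one]

/-- The block matrix `diag (X, J ᵗX⁻¹ J)`. -/
def leviMatrix (X : GL (Fin m) k) : Matrix (Fin m ⊕ Fin m) (Fin m ⊕ Fin m) k :=
  Matrix.fromBlocks X.val 0 0 (antiJ m k * ((X⁻¹).val)ᵀ * antiJ m k)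

theorem leviMatrix_one : leviMatrix m k 1 = 1 := by
  simp [leviMatrix, antiJ_mul_self]

theorem leviMatrix_mul (X Y : GL (Fin m) k) :
    leviMatrix m k (X * Y) = leviMatrix m k X * leviMatrix m k Y := by
  have h : antiJ m k * ((X⁻¹).val)ᵀ * antiJ m k * (antiJ m k * ((Y⁻¹).val)ᵀ * antiJ m k)
      = antiJ m k * (((X⁻¹).val)ᵀ * ((Y⁻¹).val)ᵀ) * antiJ m k := by
    calc _ = antiJ m k * ((X⁻¹).val)ᵀ * (antiJ m k * antiJ m k) * ((Y⁻¹).val)ᵀ * antiJ m k := by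
          simp only [Matrix.mul_assoc]
      _ = _ := by rw [antiJ_mul_self]; simp only [Matrix.mul_assoc, Matrix.one_mul]
  simp only [leviMatrix, Matrix.fromBlocks_multiply, Matrix.mul_zero, Matrix.zero_mul, add_zero,
    zero_add, h, mul_inv_rev, Units.val_mul, Matrix.transpose_mul]

/-- The embedding `X ↦ diag (X, J ᵗX⁻¹ J)` of `GL_m(k)` in `Sp_{2m}(k)`. -/
def leviEmbedding : GL (Fin m) k →* Sp m k where
  toFun X :=
    ⟨⟨leviMatrix m k X, leviMatrix m k X⁻¹,
        by rw [← leviMatrix_mul, mul_inv_cancel, leviMatrix_one],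
        by rw [← leviMatrix_mul, inv_mul_cancel, leviMatrix_one]⟩, by
      have h1 : (X.val)ᵀ * ((X⁻¹).val)ᵀ = 1 := by
        rw [← Matrix.transpose_mul, X.inv_mul, Matrix.transpose_one]
      have h2 : (X⁻¹).val * X.val = 1 := X.inv_mul
      change (leviMatrix m k X)ᵀ * sympForm m k * leviMatrix m k X = sympForm m k
      simp only [leviMatrix, sympForm, Matrix.fromBlocks_transpose, Matrix.fromBlocks_multiply,
        Matrix.transpose_zero, Matrix.transpose_mul, Matrix.transpose_transpose, antiJ_transpose,
        Matrix.mul_zero, Matrix.zero_mul, add_zero, zero_add, Matrix.mul_neg, Matrix.neg_mul,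
        neg_zero]
      congr 1
      · calc (X.val)ᵀ * antiJ m k * (antiJ m k * ((X⁻¹).val)ᵀ * antiJ m k)
            = (X.val)ᵀ * (antiJ m k * antiJ m k) * ((X⁻¹).val)ᵀ * antiJ m k := by
              simp only [Matrix.mul_assoc]
          _ = antiJ m k := by rw [antiJ_mul_self, Matrix.mul_one, h1, Matrix.one_mul]
      · congr 1
        calc antiJ m k * ((X⁻¹).val * antiJ m k) * antiJ m k * X.val
            = antiJ m k * (X⁻¹).val * (antiJ m k * antiJ m k) * X.val := by
              simp only [Matrix.mul_assoc]
          _ = antiJ m k := by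
              rw [antiJ_mul_self, Matrix.mul_one, Matrix.mul_assoc, h2, Matrix.mul_one]⟩
  map_one' := by
    apply Subtype.ext
    apply Units.ext
    exact leviMatrix_one m k
  map_mul' X Y := by
    apply Subtype.ext
    apply Units.ext
    exact leviMatrix_mul m k X Y

variable {m k}

/-- `X ∈ SL_m(k)` is regular unipotent: `X - 1` is nilpotent and `X` has a single Jordan block,
that is, `X - 1` has rank `m - 1`. -/
def IsRegularUnipotent (X : Matrix.SpecialLinearGroup (Fin m) k) : Prop :=
  IsNilpotent (X.val - 1) ∧ (X.val - 1).rank + 1 = m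

/-- `u ∈ Sp_{2m}(k)` is of type `W(m)`: up to a change of symplectic basis, `u` is a regular
unipotent element of the image of `SL_m(k)` under `X ↦ diag (X, J ᵗX⁻¹ J)`. -/
def IsOfTypeW (u : Sp m k) : Prop :=
  ∃ X : Matrix.SpecialLinearGroup (Fin m) k, IsRegularUnipotent X ∧
    IsConj (leviEmbedding m k (X : GL (Fin m) k)) u

end Symplectic

/-! ### The finite symplectic group -/

section Finite

variable (m : ℕ) (K k : Type*) [Field K] [Fintype K] [Field k] [Algebra K k]

theorem map_mem_Sp (f : k →+* k) {g : GL (Fin m ⊕ Fin m) k} (hg : g ∈ Sp m k) :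
    Matrix.GeneralLinearGroup.map f g ∈ Sp m k := by
  have hJ : (antiJ m k).map f = antiJ m k := by
    ext i j
    simp only [antiJ, Matrix.map_apply, Matrix.of_apply]
    split <;> simp
  have hS : (sympForm m k).map f = sympForm m k := by
    ext i j
    have := fun a b => congrFun (congrFun hJ a) b
    rcases i with i | i <;> rcases j with j | j <;>
      simp_all [sympForm, Matrix.map_apply]
  have h : (g.val)ᵀ * sympForm m k * g.val = sympForm m k := hg
  change (g.val.map f)ᵀ * sympForm m k * g.val.map f = sympForm m k
  have h' := congrArg (fun M => Matrix.map M f) h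
  simp only [Matrix.map_mul, hS] at h'
  rwa [Matrix.transpose_map] at h'

/-- The Frobenius endomorphism `F` of `Sp_{2m}(k)`, which raises all the entries of a matrix to
the power `q = |K|`. -/
def frobSp : Sp m k →* Sp m k :=
  ((Matrix.GeneralLinearGroup.map (FiniteField.frobeniusAlgHom K k).toRingHom).comp
    (Sp m k).subtype).codRestrict (Sp m k) fun g => map_mem_Sp m k _ g.2

/-- The finite symplectic group `Sp_{2m}(q)`, `q = |K|`: the subgroup of the fixed points of `F`
in `Sp_{2m}(k)`. -/
def SpFin : Subgroup (Sp m k) :=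
  (frobSp m K k).eqLocus (MonoidHom.id (Sp m k))

theorem mem_SpFin_iff (g : Sp m k) :
    g ∈ SpFin m K k ↔ ∀ i j, g.val.val i j ^ Fintype.card K = g.val.val i j := by
  constructor
  · intro h i j
    have h' : frobSp m K k g = g := h
    exact congrArg (fun x : Sp m k => x.val.val i j) h'
  · intro h
    change frobSp m K k g = g
    apply Subtype.ext
    apply Units.ext
    ext i j
    exact h i j

end Finite

/-! In characteristic 2, the elements of type `W(2)` are described by two equations: `A * A = 1`
with `A ≠ 1`, and `⟨v, A v⟩ = 0` for every `v`. Everything follows from this description. One class: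
for `N = A + 1` one has `N ^ 2 = 0`, `⟨v, N v⟩ = 0`, and `N` is self-adjoint. Linear algebra over
the fixed field of Frobenius then yields a symplectic basis `N x, x, N y, y` in which `A` is
standard. The change of basis already lies in the finite group, so the class does not split
(`IsAlternatingInvolution.exists_conj`). Cthulhu: the matrices that meet the linear condition and
have equal diagonal entries square to scalars, so by polarization `A B + B A = c` is scalar for two
such involutions. If `c = 0` they commute. If `c ≠ 0`, then `A B` is a root of `T ^ 2 + c T + 1`,
which has distinct roots of order dividing `q ^ 2 - 1`; hence `A B` has odd order, and `A`, `B` are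
conjugate in the dihedral group they generate. Disjoint subracks stable under both cannot separate
such a pair, while a commuting pair violates the inequalities required by types D and F. -/

/-! ### Alternating involutions: Clifford relation and normal form. -/

section AlternatingInvolutions

variable {k : Type*} [Field k]

/-- A nontrivial involution `A` of `k ^ 4` such that the form `(v, w) ↦ ⟨v, A w⟩` is
alternating. -/
structure IsAlternatingInvolution (A : Matrix (Fin 2 ⊕ Fin 2) (Fin 2 ⊕ Fin 2) k) : Prop where
  mul_self : A * A = 1
  ne_one : A ≠ 1
  alternating : ∀ v : Fin 2 ⊕ Fin 2 → k, v ⬝ᵥ (sympForm 2 k * A) *ᵥ v = 0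

theorem antiJ_two : antiJ 2 k = !![0, 1; 1, 0] := by
  ext i j
  fin_cases i <;> fin_cases j <;> simp [antiJ, Fin.rev, Fin.ext_iff]

theorem dotProduct_sympForm_mulVec (v w : Fin 2 ⊕ Fin 2 → k) :
    v ⬝ᵥ sympForm 2 k *ᵥ w = v (.inl 0) * w (.inr 1) + v (.inl 1) * w (.inr 0)
      - v (.inr 0) * w (.inl 1) - v (.inr 1) * w (.inl 0) := by
  simp [sympForm, antiJ_two, dotProduct, Matrix.mulVec, Matrix.fromBlocks]
  ring

theorem IsAlternatingInvolution.exists_eq_fromBlocks [CharP k 2]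
    {A : Matrix (Fin 2 ⊕ Fin 2) (Fin 2 ⊕ Fin 2) k} (hA : IsAlternatingInvolution A) :
    ∃ d x y r s : k, A = Matrix.fromBlocks !![d, x; y, d] !![r, 0; 0, r]
      !![s, 0; 0, s] !![d, x; y, d] := by
  have h2 : (2 : k) = 0 := CharTwo.two_eq_zero
  have alt : ∀ a b c d : k, _ := fun a b c d => hA.alternating (Sum.elim ![a, b] ![c, d])
  simp only [← Matrix.mulVec_mulVec, dotProduct_sympForm_mulVec] at alt
  simp [Matrix.mulVec, dotProduct] at alt
  -- Basis vectors and sums of two of them detect all coefficients of the quadratic form `⟨v, A v⟩`.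
  have e1 := alt 1 0 0 0
  have e2 := alt 0 1 0 0
  have e3 := alt 0 0 1 0
  have e4 := alt 0 0 0 1
  have e12 := alt 1 1 0 0
  have e13 := alt 1 0 1 0
  have e14 := alt 1 0 0 1
  have e23 := alt 0 1 1 0
  have e24 := alt 0 1 0 1
  have e34 := alt 0 0 1 1
  simp at e1 e2 e3 e4 e12 e13 e14 e23 e24 e34
  have s1 := congrFun (congrFun hA.mul_self (.inl 0)) (.inl 0)
  have s2 := congrFun (congrFun hA.mul_self (.inl 1)) (.inl 1)
  simp [Matrix.mul_apply] at s1 s2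
  -- Two diagonal entries of `A ^ 2 = 1` differ by the difference of the squares of those of `A`,
  -- which is a square in characteristic 2.
  have key : (A (.inl 0) (.inl 0) - A (.inl 1) (.inl 1)) ^ 2 = 0 := by grind
  have key' := sub_eq_zero.mp (pow_eq_zero_iff two_ne_zero |>.mp key)
  refine ⟨A (.inl 0) (.inl 0), A (.inl 0) (.inl 1), A (.inl 1) (.inl 0), A (.inl 0) (.inr 0),
    A (.inr 0) (.inl 0), ?_⟩
  ext i j
  rcases i with i | i <;> rcases j with j | j <;> fin_cases i <;> fin_cases j <;>
    simp <;> grind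

/-- Two alternating involutions satisfy a Clifford relation. -/
theorem IsAlternatingInvolution.exists_anticommutator_eq [CharP k 2]
    {A B : Matrix (Fin 2 ⊕ Fin 2) (Fin 2 ⊕ Fin 2) k} (hA : IsAlternatingInvolution A)
    (hB : IsAlternatingInvolution B) :
    ∃ c : k, A * B + B * A = c • 1 := by
  have h2 : (2 : k) = 0 := CharTwo.two_eq_zero
  obtain ⟨d, x, y, r, s, rfl⟩ := hA.exists_eq_fromBlocks
  obtain ⟨d', x', y', r', s', rfl⟩ := hB.exists_eq_fromBlocks
  -- Polarization of `d ^ 2 + x y + r s`, the scalar by which the square of such a block matrix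
  -- acts; the term `2 d d'` vanishes.
  refine ⟨x * y' + y * x' + r * s' + s * r', ?_⟩
  rw [Matrix.fromBlocks_multiply, Matrix.fromBlocks_multiply, Matrix.fromBlocks_add,
    ← Matrix.fromBlocks_one, Matrix.fromBlocks_smul]
  congr 1 <;> ext i j <;> fin_cases i <;> fin_cases j <;> simp <;> grind

theorem Matrix.exists_dotProduct_ne_zero {n : Type*} [Fintype n] [DecidableEq n]
    {M : Matrix n n k} (hM : M ≠ 0) : ∃ i j, Pi.single i 1 ⬝ᵥ M *ᵥ Pi.single j 1 ≠ 0 := by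
  by_contra! h
  exact hM (by ext i j; simpa using h i j)

theorem sympForm_mul_self [CharP k 2] : sympForm 2 k * sympForm 2 k = 1 := by
  rw [sympForm, Matrix.fromBlocks_multiply, ← Matrix.fromBlocks_one]
  simp [antiJ_mul_self, CharTwo.neg_eq]

theorem isUnit_of_preserves_sympForm [CharP k 2] {g : Matrix (Fin 2 ⊕ Fin 2) (Fin 2 ⊕ Fin 2) k}
    (hg : gᵀ * sympForm 2 k * g = sympForm 2 k) : IsUnit g := by
  rw [Matrix.isUnit_iff_isUnit_det]
  have h := congrArg Matrix.det hg
  have hΩ : (sympForm 2 k).det ≠ 0 := fun h0 => by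
    simpa [h0] using congrArg Matrix.det (sympForm_mul_self (k := k))
  rw [Matrix.det_mul] at h
  exact isUnit_iff_ne_zero.mpr (right_ne_zero_of_mul (h ▸ hΩ))

variable (k) in
/-- The standard alternating involution. -/
def standardInvolution : Matrix (Fin 2 ⊕ Fin 2) (Fin 2 ⊕ Fin 2) k :=
  Matrix.fromBlocks !![1, 1; 0, 1] 0 0 !![1, 1; 0, 1]

/-- Every alternating involution that preserves the symplectic form is conjugate to the standard
one, by a symplectic matrix with entries in any given subfield that contains the entries of `A`. -/
theorem IsAlternatingInvolution.exists_conj [CharP k 2]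
    {A : Matrix (Fin 2 ⊕ Fin 2) (Fin 2 ⊕ Fin 2) k} (hA : IsAlternatingInvolution A)
    (F : Subfield k) (hF : ∀ i j, A i j ∈ F) :
    ∃ g : Matrix (Fin 2 ⊕ Fin 2) (Fin 2 ⊕ Fin 2) k, (∀ i j, g i j ∈ F) ∧
      gᵀ * sympForm 2 k * g = sympForm 2 k ∧ g * standardInvolution k = A * g := by
  have h2 : (2 : k) = 0 := CharTwo.two_eq_zero
  let b : (Fin 2 ⊕ Fin 2 → k) → (Fin 2 ⊕ Fin 2 → k) → k := fun v w => v ⬝ᵥ sympForm 2 k *ᵥ w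
  have b_add (u v w) : b u (v + w) = b u v + b u w := by
    simp [b, Matrix.mulVec_add, dotProduct_add]
  have add_b (u v w) : b (u + v) w = b u w + b v w := by simp [b, add_dotProduct]
  have b_smul (c : k) (v w) : b v (c • w) = c * b v w := by
    simp [b, Matrix.mulVec_smul, dotProduct_smul]
  have b_self (v) : b v v = 0 := by simp only [b, dotProduct_sympForm_mulVec]; grind
  have b_comm (v w) : b v w = b w v := by simp only [b, dotProduct_sympForm_mulVec]; grind
  let N : (Fin 2 ⊕ Fin 2 → k) → (Fin 2 ⊕ Fin 2 → k) := fun v => A *ᵥ v + v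
  have N_add (v w) : N (v + w) = N v + N w := by
    simp only [N, Matrix.mulVec_add]; abel
  have N_smul (c : k) (v) : N (c • v) = c • N v := by
    simp only [N, Matrix.mulVec_smul, smul_add]
  have A_eq (v) : A *ᵥ v = v + N v := by
    ext i; simp only [N, Pi.add_apply]; grind
  have N_N (v) : N (N v) = 0 := by
    ext i
    simp only [N, Matrix.mulVec_add, Matrix.mulVec_mulVec, hA.mul_self, Matrix.one_mulVec,
      Pi.add_apply, Pi.zero_apply]
    grind
  have b_N (v) : b v (N v) = 0 := by
    have := hA.alternating v
    rw [← Matrix.mulVec_mulVec] at this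
    simp only [N, b_add, b_self, add_zero]
    exact this
  -- Polarize `b v (N v) = 0`.
  have b_N_comm (v w) : b (N v) w = b v (N w) := by
    have := b_N (v + w)
    rw [N_add, add_b, b_add v (N v), b_add w (N v), b_N, b_N, b_comm w] at this
    grind
  have F_N {v : Fin 2 ⊕ Fin 2 → k} (hv : ∀ i, v i ∈ F) (i) : N v i ∈ F := by
    refine F.add_mem ?_ (hv i)
    rw [Matrix.mulVec, dotProduct]
    exact F.sum_mem fun j _ => F.mul_mem (hF i j) (hv j)
  have F_b {v w : Fin 2 ⊕ Fin 2 → k} (hv : ∀ i, v i ∈ F) (hw : ∀ i, w i ∈ F) : b v w ∈ F := by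
    simp only [b, dotProduct_sympForm_mulVec]
    exact F.sub_mem (F.sub_mem (F.add_mem (F.mul_mem (hv _) (hw _)) (F.mul_mem (hv _) (hw _)))
      (F.mul_mem (hv _) (hw _))) (F.mul_mem (hv _) (hw _))
  have F_single (i j) : (Pi.single i 1 : Fin 2 ⊕ Fin 2 → k) j ∈ F := by
    rw [Pi.single_apply]; split
    exacts [F.one_mem, F.zero_mem]
  obtain ⟨x, z, hx, hz, hxz⟩ : ∃ x z : Fin 2 ⊕ Fin 2 → k, (∀ i, x i ∈ F) ∧ (∀ i, z i ∈ F) ∧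
      b x (N z) ≠ 0 := by
    have hM : sympForm 2 k * (A + 1) ≠ 0 := fun h => hA.ne_one <| by
      have := congrArg (sympForm 2 k * ·) h
      simp only [← Matrix.mul_assoc, sympForm_mul_self, Matrix.one_mul, Matrix.mul_zero] at this
      ext i j
      have := congrFun (congrFun this i) j
      simp only [Matrix.add_apply, Matrix.zero_apply] at this
      grind
    obtain ⟨i, j, h⟩ := Matrix.exists_dotProduct_ne_zero hM
    refine ⟨_, _, F_single i, F_single j, ?_⟩
    rwa [← Matrix.mulVec_mulVec, Matrix.add_mulVec, Matrix.one_mulVec] at h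
  obtain ⟨y, hy, hxy, hxy'⟩ : ∃ y : Fin 2 ⊕ Fin 2 → k, (∀ i, y i ∈ F) ∧ b x (N y) = 1 ∧
      b x y = 0 := by
    have hw : ∀ i, ((b x (N z))⁻¹ • z) i ∈ F := fun i =>
      F.mul_mem (F.inv_mem (F_b hx (F_N hz))) (hz i)
    have hxw : b x (N ((b x (N z))⁻¹ • z)) = 1 := by
      rw [N_smul, b_smul, inv_mul_cancel₀ hxz]
    generalize (b x (N z))⁻¹ • z = w at hw hxw
    -- Since `b x (N w) = 1`, this correction makes `b x y` equal to `2 * b x w = 0`; it leaves `N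
    -- w` unchanged because `N ^ 2 = 0`.
    refine ⟨w + b x w • N w, fun i => F.add_mem (hw i) (F.mul_mem (F_b hx hw) (F_N hw i)), ?_, ?_⟩
    · rw [N_add, N_smul, N_N, smul_zero, add_zero, hxw]
    · rw [b_add, b_smul, hxw]; grind
  -- In this order the Gram matrix is `sympForm`: `N x` pairs with `y`, and `x` with `N y`. Moreover
  -- `A` fixes `N x`, `N y` and adds them to `x`, `y`.
  let c : Fin 2 ⊕ Fin 2 → (Fin 2 ⊕ Fin 2 → k) := Sum.elim ![N x, x] ![N y, y]
  refine ⟨Matrix.of fun i j => c j i, ?_, ?_, ?_⟩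
  · rintro i (j | j) <;> fin_cases j
    exacts [F_N hx i, hx i, F_N hy i, hy i]
  · have hc : ∀ i j, ((Matrix.of fun i j => c j i)ᵀ * sympForm 2 k *
        (Matrix.of fun i j => c j i)) i j = b (c i) (c j) := by
      intro i j
      rw [Matrix.mul_assoc]
      rfl
    have z1 (v w) : b (N v) (N w) = 0 := by rw [b_N_comm, N_N]; simp [b]
    have z2 (v) : b (N v) v = 0 := by rw [b_comm, b_N]
    have z3 : b y x = 0 := by rw [b_comm, hxy']
    have z4 : b (N x) y = 1 := by rw [b_N_comm, hxy]
    have z5 : b y (N x) = 1 := by rw [b_comm, z4]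
    have z6 : b (N y) x = 1 := by rw [b_comm, hxy]
    ext i j
    rw [hc]
    rcases i with i | i <;> rcases j with j | j <;> fin_cases i <;> fin_cases j <;>
      simp [c, sympForm, antiJ_two, z1, z2, z3, z4, z5, z6, hxy, hxy', b_self, b_N, CharTwo.neg_eq]
  · have hc : ∀ i j, (A * (Matrix.of fun i j => c j i)) i j = (A *ᵥ c j) i := fun i j => rfl
    ext i j
    rw [hc, A_eq]
    rcases j with j | j <;> fin_cases j <;>
      simp [c, standardInvolution, Matrix.mul_apply, N_N, add_comm]

end AlternatingInvolutions

/-! ### Type `W(2)` elements and their single class in the finite group. -/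

section TypeW

variable {k : Type*} [Field k]

/-- Nilpotency of `X - 1` gives trace `2 = 0`, so Cayley–Hamilton with determinant 1 reads `X ^ 2 =
-1 = 1`. -/
theorem IsRegularUnipotent.mul_self [CharP k 2] {X : Matrix.SpecialLinearGroup (Fin 2) k}
    (hX : IsRegularUnipotent X) : X.val * X.val = 1 := by
  have h2 : (2 : k) = 0 := CharTwo.two_eq_zero
  have htr := (Matrix.isNilpotent_trace_of_isNilpotent hX.1).eq_zero
  have hdet := X.2
  rw [Matrix.det_fin_two] at hdet
  simp [Matrix.trace_fin_two] at htr
  ext i j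
  fin_cases i <;> fin_cases j <;> simp [Matrix.mul_apply] <;> grind

theorem IsRegularUnipotent.ne_one {X : Matrix.SpecialLinearGroup (Fin 2) k}
    (hX : IsRegularUnipotent X) : X.val ≠ 1 := by
  intro h
  have := hX.2
  rw [h, sub_self, Matrix.rank_zero] at this
  omega

theorem antiJ_mul_transpose_mul_antiJ (X : Matrix (Fin 2) (Fin 2) k) :
    antiJ 2 k * Xᵀ * antiJ 2 k = !![X 1 1, X 0 1; X 1 0, X 0 0] := by
  rw [antiJ_two]
  ext i j
  fin_cases i <;> fin_cases j <;> simp only [Matrix.mul_apply, Fin.sum_univ_two] <;> simp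

theorem val_leviEmbedding_of_mul_self {X : GL (Fin 2) k} (hX : X.val * X.val = 1) :
    (leviEmbedding 2 k X).val.val
      = Matrix.fromBlocks X.val 0 0
        !![X.val 1 1, X.val 0 1; X.val 1 0, X.val 0 0] := by
  have : X⁻¹ = X := inv_eq_of_mul_eq_one_left (Units.ext hX)
  change leviMatrix 2 k X = _
  rw [leviMatrix, this, antiJ_mul_transpose_mul_antiJ]

/-- As `X⁻¹ = X`, the lower block is `J ᵗX J`. For `v = (a, b)` the two terms of `⟨v, A v⟩` are then
`ᵗ(X a) J b` and `-ᵗb J (X a)`, which cancel. -/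
theorem isAlternatingInvolution_leviEmbedding [CharP k 2]
    {X : Matrix.SpecialLinearGroup (Fin 2) k} (hX : IsRegularUnipotent X) :
    IsAlternatingInvolution (leviEmbedding 2 k (X : GL (Fin 2) k)).val.val := by
  have h2 : (2 : k) = 0 := CharTwo.two_eq_zero
  have hXX : (X : GL (Fin 2) k) * (X : GL (Fin 2) k) = 1 := Units.ext hX.mul_self
  have hval := val_leviEmbedding_of_mul_self (X := (X : GL (Fin 2) k)) hX.mul_self
  refine ⟨?_, ?_, ?_⟩
  · have := congrArg (fun g : Sp 2 k => g.val.val) (congrArg (leviEmbedding 2 k) hXX)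
    rwa [map_mul, map_one] at this
  · intro h
    rw [hval, ← Matrix.fromBlocks_one, Matrix.fromBlocks_inj] at h
    exact hX.ne_one h.1
  · intro v
    rw [hval, ← Matrix.mulVec_mulVec, dotProduct_sympForm_mulVec]
    simp [Matrix.mulVec, dotProduct]
    grind

/-- A symplectic `g` with `v g = g u` gives `⟨g y, v g y⟩ = ⟨g y, g u y⟩ = ⟨y, u y⟩`. -/
theorem IsAlternatingInvolution.of_isConj [CharP k 2] {u v : Sp 2 k} (h : IsConj u v)
    (hu : IsAlternatingInvolution u.val.val) : IsAlternatingInvolution v.val.val := by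
  obtain ⟨g, hg⟩ := isConj_iff.mp h
  have hsq (w : Sp 2 k) : w * w = 1 ↔ w.val.val * w.val.val = 1 :=
    ⟨fun h => congrArg (fun w : Sp 2 k => w.val.val) h, fun h => Subtype.ext (Units.ext h)⟩
  have hone (w : Sp 2 k) : w = 1 ↔ w.val.val = 1 :=
    ⟨fun h => congrArg (fun w : Sp 2 k => w.val.val) h, fun h => Subtype.ext (Units.ext h)⟩
  refine ⟨?_, ?_, fun x => ?_⟩
  · rw [← hsq, ← hg]
    have := (hsq u).mpr hu.mul_self
    rw [show g * u * g⁻¹ * (g * u * g⁻¹) = g * (u * u) * g⁻¹ by group, this]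
    group
  · rw [Ne, ← hone, ← hg, conj_eq_one_iff, hone]
    exact hu.ne_one
  · have hgx : x = g.val.val *ᵥ (g⁻¹).val.val *ᵥ x := by
      rw [Matrix.mulVec_mulVec]
      have : g.val.val * (g⁻¹).val.val = 1 :=
        congrArg (fun w : Sp 2 k => w.val.val) (mul_inv_cancel g)
      rw [this, Matrix.one_mulVec]
    have hvg : v.val.val * g.val.val = g.val.val * u.val.val :=
      congrArg (fun w : Sp 2 k => w.val.val) (show v * g = g * u by rw [← hg]; group)
    generalize (g⁻¹).val.val *ᵥ x = y at hgx
    subst hgx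
    have hΩ : (g.val.val)ᵀ * sympForm 2 k * g.val.val = sympForm 2 k := g.2
    rw [Matrix.mulVec_mulVec, Matrix.mul_assoc, hvg, ← Matrix.vecMul_transpose,
      ← Matrix.dotProduct_mulVec, Matrix.mulVec_mulVec, ← Matrix.mul_assoc, ← Matrix.mul_assoc, hΩ]
    exact hu.alternating y

variable (k) in
theorem rank_single_zero_one : (!![0, 1; 0, 0] : Matrix (Fin 2) (Fin 2) k).rank = 1 := by
  classical
  have hD : (Matrix.diagonal ![(1 : k), 0]).rank = 1 := by
    rw [Matrix.rank_diagonal, Fintype.card_subtype]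
    simp [Finset.filter, Fin.univ_succ]
  have e1 : (!![0, 1; 0, 0] : Matrix (Fin 2) (Fin 2) k)
      = Matrix.diagonal ![(1 : k), 0] * !![0, 1; 1, 0] := by
    ext i j; fin_cases i <;> fin_cases j <;> simp
  have e2 : Matrix.diagonal ![(1 : k), 0]
      = (!![0, 1; 0, 0] : Matrix (Fin 2) (Fin 2) k) * !![0, 1; 1, 0] := by
    ext i j; fin_cases i <;> fin_cases j <;> simp
  apply le_antisymm
  · exact (e1 ▸ Matrix.rank_mul_le_left _ _).trans_eq hD
  · exact hD.symm.trans_le (e2 ▸ Matrix.rank_mul_le_left _ _)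

variable (k) in
/-- The transvection `!![1, 1; 0, 1]`. -/
def upperTransvection : Matrix.SpecialLinearGroup (Fin 2) k :=
  ⟨!![1, 1; 0, 1], by simp [Matrix.det_fin_two]⟩

variable (k) in
theorem upperTransvection_val_sub_one : (upperTransvection k).val - 1 = !![0, 1; 0, 0] := by
  ext i j; fin_cases i <;> fin_cases j <;> simp [upperTransvection]

variable (k) in
theorem isRegularUnipotent_upperTransvection : IsRegularUnipotent (upperTransvection k) := by
  rw [IsRegularUnipotent, upperTransvection_val_sub_one, rank_single_zero_one]
  refine ⟨⟨2, ?_⟩, rfl⟩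
  ext i j; fin_cases i <;> fin_cases j <;> simp [pow_two]

variable (k) in
/-- The standard alternating involution, as an element of the symplectic group. -/
def standardSp : Sp 2 k := leviEmbedding 2 k (upperTransvection k : GL (Fin 2) k)

variable (k) in
theorem standardSp_val [CharP k 2] : (standardSp k).val.val = standardInvolution k := by
  rw [standardSp, val_leviEmbedding_of_mul_self
    (isRegularUnipotent_upperTransvection k).mul_self, standardInvolution]
  rfl

theorem IsOfTypeW.isAlternatingInvolution [CharP k 2] {u : Sp 2 k} (hu : IsOfTypeW u) :
    IsAlternatingInvolution u.val.val := by
  obtain ⟨X, hX, h⟩ := hu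
  exact (isAlternatingInvolution_leviEmbedding hX).of_isConj h

theorem isOfTypeW_of_isConj_standardSp {u : Sp 2 k} (hu : IsConj (standardSp k) u) :
    IsOfTypeW u :=
  ⟨_, isRegularUnipotent_upperTransvection k, hu⟩

variable (K : Type*) [Field K] [Fintype K] [Algebra K k]

variable (k) in
/-- The subfield of `k` fixed by the Frobenius map `x ↦ x ^ |K|`. -/
def frobFixed : Subfield k :=
  (FiniteField.frobeniusAlgHom K k).toRingHom.eqLocusField (RingHom.id k)

theorem mem_frobFixed_iff {x : k} : x ∈ frobFixed k K ↔ x ^ Fintype.card K = x := Iff.rfl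

variable (k) in
/-- The standard alternating involution, as an element of the finite symplectic group. -/
def standardSpFin [CharP k 2] : SpFin 2 K k :=
  ⟨standardSp k, by
    rw [mem_SpFin_iff]
    intro i j
    rw [standardSp_val, standardInvolution, ← mem_frobFixed_iff]
    have h0 := (frobFixed k K).zero_mem
    have h1 := (frobFixed k K).one_mem
    rcases i with i | i <;> rcases j with j | j <;> fin_cases i <;> fin_cases j <;>
      simp [h0, h1]⟩

/-- The conjugating matrix can be chosen with Frobenius-fixed entries, so conjugacy descends to the
finite group by linear algebra alone. -/
theorem isConj_standardSpFin [CharP k 2] {u : SpFin 2 K k} (hu : IsOfTypeW (u : Sp 2 k)) :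
    IsConj (standardSpFin k K) u := by
  obtain ⟨g, hgF, hg, hgu⟩ := hu.isAlternatingInvolution.exists_conj (frobFixed k K)
    ((mem_SpFin_iff 2 K k u.val).mp u.2)
  let g' : Sp 2 k := ⟨(isUnit_of_preserves_sympForm hg).unit, hg⟩
  refine isConj_iff.mpr ⟨⟨g', (mem_SpFin_iff 2 K k g').mpr hgF⟩, ?_⟩
  rw [mul_inv_eq_iff_eq_mul]
  apply Subtype.ext
  apply Subtype.ext
  apply Units.ext
  change g * (standardSp k).val.val = u.val.val.val * g
  rw [standardSp_val, hgu]

theorem isOfTypeW_iff_mem_carrier [CharP k 2] (u : SpFin 2 K k) :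
    IsOfTypeW (u : Sp 2 k) ↔ u ∈ (ConjClasses.mk (standardSpFin k K)).carrier := by
  rw [ConjClasses.mem_carrier_iff_mk_eq, ConjClasses.mk_eq_mk_iff_isConj]
  exact ⟨fun hu => (isConj_standardSpFin K hu).symm, fun h =>
    isOfTypeW_of_isConj_standardSp ((SpFin 2 K k).subtype.map_isConj h.symm)⟩

theorem classesWithin_eq_of_isOfTypeW [CharP k 2] {u : SpFin 2 K k}
    (hu : IsOfTypeW (u : Sp 2 k)) :
    classesWithin (SpFin 2 K k) (u : Sp 2 k) = {ConjClasses.mk (standardSpFin k K)} := by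
  ext C
  rw [Set.mem_singleton_iff]
  constructor
  · intro hC
    obtain ⟨y, rfl⟩ := ConjClasses.mk_surjective C
    have huy := hC y ConjClasses.mem_carrier_mk
    obtain ⟨X, hX, h⟩ := hu
    have hy : IsOfTypeW (y : Sp 2 k) := ⟨X, hX, h.trans huy⟩
    exact (ConjClasses.mk_eq_mk_iff_isConj.mpr (isConj_standardSpFin K hy)).symm
  · rintro rfl y hy
    have hy' := (isOfTypeW_iff_mem_carrier K y).mpr hy
    exact (SpFin 2 K k).subtype.map_isConj
      ((isConj_standardSpFin K hu).symm.trans (isConj_standardSpFin K hy'))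

end TypeW

/-! ### Odd order of products, and conjugacy in dihedral groups. -/

section OddOrder

/-- A root of a reciprocal quadratic polynomial `X ^ 2 + c X + 1` over a finite field of
characteristic two is a root of unity of odd order. -/
theorem pow_card_sq_sub_one_eq_one {k : Type*} [Field k] [CharP k 2] (K : Type*) [Field K]
    [Fintype K] [Algebra K k] {c l : k} (hc : c ^ Fintype.card K = c)
    (hl : l ^ 2 + c * l + 1 = 0) : l ^ (Fintype.card K ^ 2 - 1) = 1 := by
  have h2 : (2 : k) = 0 := CharTwo.two_eq_zero
  have hl0 : l ≠ 0 := by rintro rfl; simp at hl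
  -- Frobenius fixes `c`, so it permutes the roots `l` and `l⁻¹`; hence `l ^ q` is one of these.
  have key : (l ^ Fintype.card K) ^ 2 + c * l ^ Fintype.card K + 1 = 0 := by
    have := congrArg (FiniteField.frobeniusAlgHom K k) hl
    simp only [map_add, map_mul, map_pow, map_one, map_zero] at this
    simp only [FiniteField.frobeniusAlgHom_apply, hc] at this
    exact this
  have hfac : (l ^ Fintype.card K - l) * (l ^ Fintype.card K * l - 1) = 0 := by grind
  -- In either case applying Frobenius twice returns `l`.
  have hq : l ^ (Fintype.card K ^ 2 - 1) * l = l := by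
    rw [← pow_succ, Nat.sub_add_cancel (Nat.one_le_pow _ _ Fintype.card_pos), pow_two, pow_mul]
    rcases mul_eq_zero.mp hfac with h | h
    · rw [sub_eq_zero.mp h, sub_eq_zero.mp h]
    · rw [eq_inv_of_mul_eq_one_left (sub_eq_zero.mp h), inv_pow,
        eq_inv_of_mul_eq_one_left (sub_eq_zero.mp h), inv_inv]
  exact mul_right_cancel₀ hl0 (by rw [hq, one_mul])

/-- If `A + A⁻¹` is a nonzero scalar in the finite field, then `A` has odd order. -/
theorem pow_card_sq_sub_one_eq_one_of_quadratic {k R : Type*} [Field k] [IsAlgClosed k]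
    [CharP k 2] [Ring R] [Algebra k R] (K : Type*) [Field K] [Fintype K] [Algebra K k] {c : k}
    (hc : c ^ Fintype.card K = c) (hc0 : c ≠ 0) {A : R} (hA : A * A = c • A - 1) :
    A ^ (Fintype.card K ^ 2 - 1) = 1 := by
  have h2 : (2 : k) = 0 := CharTwo.two_eq_zero
  obtain ⟨l, hl⟩ : ∃ l : k, l ^ 2 + c * l + 1 = 0 := by
    obtain ⟨l, hl⟩ := IsAlgClosed.exists_root
      (Polynomial.C 1 * Polynomial.X ^ 2 + Polynomial.C c * Polynomial.X + Polynomial.C 1 :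
        Polynomial k) (by rw [Polynomial.degree_quadratic one_ne_zero]; decide)
    exact ⟨l, by simpa [Polynomial.IsRoot] using hl⟩
  have hmu : (l + c) ^ 2 + c * (l + c) + 1 = 0 := by grind
  -- Lagrange interpolation of `T ^ n` at the roots `l` and `l + c`, cleared of the denominator `c`.
  have hpow (n : ℕ) : c • A ^ n
      = l ^ n • (A - (l + c) • (1 : R)) + (l + c) ^ n • (c • (1 : R) - (A - (l + c) • 1)) := by
    induction n with
    | zero => simp
    | succ n ih =>
      rw [pow_succ, ← smul_mul_assoc, ih, add_mul, smul_mul_assoc, smul_mul_assoc, sub_mul,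
        sub_mul, sub_mul, smul_mul_assoc, smul_mul_assoc, one_mul, hA]
      match_scalars <;> grind
  have h := hpow (Fintype.card K ^ 2 - 1)
  rw [pow_card_sq_sub_one_eq_one K hc hl, pow_card_sq_sub_one_eq_one K hc hmu, one_smul,
    one_smul, add_sub_cancel] at h
  exact smul_right_injective R hc0 h

/-- Two involutions whose product has odd order are conjugate in the subgroup they generate. -/
theorem mem_of_odd_pow_eq_one {H : Type*} [Group H] {r s : H} (hr : r * r = 1) (hs : s * s = 1)
    {n : ℕ} (hn : (r * s) ^ (2 * n + 1) = 1) {R : Set H} (hrR : r ∈ R)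
    (h1 : ∀ x ∈ R, r * x * r⁻¹ ∈ R) (h2 : ∀ x ∈ R, s * x * s⁻¹ ∈ R) : s ∈ R := by
  have hmem (j : ℕ) : (r * s) ^ j * r * ((r * s) ^ j)⁻¹ ∈ R := by
    induction j with
    | zero => simpa using hrR
    | succ j ih =>
      have := h1 _ (h2 _ ih)
      rw [pow_succ', mul_inv_rev, mul_inv_rev]
      simpa only [mul_assoc] using this
  have hr' : r⁻¹ = r := inv_eq_of_mul_eq_one_left hr
  have hs' : s⁻¹ = s := inv_eq_of_mul_eq_one_left hs
  have hinv : (r * s)⁻¹ = s * r := by rw [mul_inv_rev, hr', hs']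
  have hconj : r * ((r * s) ^ n)⁻¹ = (r * s) ^ n * r := by
    have : SemiconjBy r (r * s)⁻¹ (r * s) := by
      rw [SemiconjBy, hinv, mul_assoc]
    rw [← inv_pow]
    exact this.pow_right n
  -- Since `r` inverts `r s`, the left side is `(r s) ^ (2 n) r = (r s)⁻¹ r = s`.
  have heq : (r * s) ^ n * r * ((r * s) ^ n)⁻¹ = s := by
    rw [mul_assoc, hconj, ← mul_assoc, ← pow_add, ← two_mul]
    rw [pow_succ, mul_eq_one_iff_eq_inv, hinv] at hn
    rw [hn, mul_assoc, hr, mul_one]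
  exact heq ▸ hmem n

end OddOrder

/-! ### A rack-theoretic criterion for being cthulhu. -/

section Cthulhu

universe v

/-- A rack in which any two elements either commute, or are linked by every subset that both of
them stabilise, is cthulhu. -/
theorem isCthulhu_of_commute_or_mem {X : Type v} [Rack X] (hX : ∀ x : X, x ◃ x = x)
    (h : ∀ r s : X, (r ◃ s = s ∧ s ◃ r = r) ∨
      ∀ R : Set X, r ∈ R → (∀ x ∈ R, r ◃ x ∈ R) → (∀ x ∈ R, s ◃ x ∈ R) → s ∈ R) :
    IsCthulhu X := by
  constructor
  · rintro ⟨R, S, hR, hS, hRS, hU, r, hr, s, hs, hrs⟩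
    rcases h r s with ⟨h1, -⟩ | h
    · exact hrs (by rw [h1, hX, h1])
    · refine Set.disjoint_left.mp hRS (h R hr ?_ ?_) hs
      · intro x hx
        exact (hR.2 r hr).subset (Set.mem_image_of_mem _ hx)
      · intro x hx
        -- The action of `s` is injective, preserves `R ∪ S` and maps `S` onto `S`, so it cannot
        -- send a point of `R` into `S`.
        rcases (hU.2 s (.inr hs)).subset (Set.mem_image_of_mem _ (.inl hx)) with h | h
        · exact h
        · obtain ⟨y, hy, hxy⟩ := (hS.2 s hs).superset h
          have : y = x := (Rack.act' s).injective hxy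
          exact (Set.disjoint_left.mp hRS hx (this ▸ hy)).elim
  · rintro ⟨R, r, hR, hdisj, hact, hr, hne⟩
    -- Two of the four subracks already give the contradiction.
    rcases h (r 0) (r 1) with ⟨h1, -⟩ | h
    · exact hne 0 1 (by decide) h1
    · refine Set.disjoint_left.mp (hdisj 0 1 (by decide)) (h (R 0) (hr 0) ?_ ?_) (hr 1)
      · exact fun x hx => (hact 0 0).subset (Set.mem_image2_of_mem (hr 0) hx)
      · exact fun x hx => (hact 1 0).subset (Set.mem_image2_of_mem (hr 1) hx)

end Cthulhu

/-! ### Application to the class of type `W(2)`. -/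

section TypeW

variable {K k : Type*} [Field K] [Fintype K] [Field k] [Algebra K k] [IsAlgClosed k] [CharP k 2]

/-- Two elements of type `W(2)` of the finite symplectic group commute, or their product has
odd order. -/
theorem mul_comm_or_pow_eq_one_of_isOfTypeW {u v : SpFin 2 K k} (hu : IsOfTypeW (u : Sp 2 k))
    (hv : IsOfTypeW (v : Sp 2 k)) :
    u * v = v * u ∨ (u * v) ^ (Fintype.card K ^ 2 - 1) = 1 := by
  have h2 : (2 : k) = 0 := CharTwo.two_eq_zero
  let f : SpFin 2 K k →* Matrix (Fin 2 ⊕ Fin 2) (Fin 2 ⊕ Fin 2) k :=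
    (Units.coeHom _).comp ((Sp 2 k).subtype.comp (SpFin 2 K k).subtype)
  have hf : Function.Injective f := fun a b h => Subtype.ext (Subtype.ext (Units.ext h))
  have hu' : IsAlternatingInvolution (f u) := hu.isAlternatingInvolution
  have hv' : IsAlternatingInvolution (f v) := hv.isAlternatingInvolution
  obtain ⟨c, hc⟩ := hu'.exists_anticommutator_eq hv'
  by_cases hc0 : c = 0
  · left
    apply hf
    rw [map_mul, map_mul]
    ext i j
    have := congrFun (congrFun hc i) j
    rw [hc0, zero_smul, Matrix.add_apply, Matrix.zero_apply] at this
    grind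
  · right
    -- The scalar `c` is a diagonal entry of `u v + v u`, whose entries are Frobenius-fixed.
    have hcF : c ∈ frobFixed k K := by
      have hF (w : SpFin 2 K k) (i j) : f w i j ∈ frobFixed k K :=
        (mem_SpFin_iff 2 K k w.val).mp w.2 i j
      have := congrFun (congrFun hc (.inl 0)) (.inl 0)
      rw [← map_mul, ← map_mul] at this
      simp only [Matrix.add_apply, Matrix.smul_apply, Matrix.one_apply_eq, smul_eq_mul,
        mul_one] at this
      exact this ▸ add_mem (hF _ _ _) (hF _ _ _)
    apply hf
    rw [map_pow, map_one]
    refine pow_card_sq_sub_one_eq_one_of_quadratic K ((mem_frobFixed_iff K).mp hcF) hc0 ?_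
    rw [map_mul, eq_sub_iff_add_eq]
    -- Writing `1` as `(u v) (v u)` factors the sum as `(u v) (u v + v u)`.
    calc f u * f v * (f u * f v) + 1
        = f u * f v * (f u * f v) + f u * (f v * f v) * f u := by
          rw [hv'.mul_self, mul_one, hu'.mul_self]
      _ = f u * f v * (f u * f v + f v * f u) := by noncomm_ring
      _ = c • (f u * f v) := by rw [hc, mul_smul_comm, mul_one]

theorem isCthulhu_carrier_standardSpFin (hq : Even (Fintype.card K)) :
    IsCthulhu (ConjClasses.mk (standardSpFin k K)).carrier := by
  have hsq (w : SpFin 2 K k) (hw : IsOfTypeW (w : Sp 2 k)) : w * w = 1 :=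
    Subtype.ext (Subtype.ext (Units.ext hw.isAlternatingInvolution.mul_self))
  refine isCthulhu_of_commute_or_mem (fun x => Subtype.ext ?_) ?_
  · exact mul_inv_cancel_right _ _
  rintro ⟨u, hu⟩ ⟨v, hv⟩
  have hu' := (isOfTypeW_iff_mem_carrier K u).mpr hu
  have hv' := (isOfTypeW_iff_mem_carrier K v).mpr hv
  rcases mul_comm_or_pow_eq_one_of_isOfTypeW hu' hv' with h | h
  · left
    exact ⟨Subtype.ext (mul_inv_eq_of_eq_mul h), Subtype.ext (mul_inv_eq_of_eq_mul h.symm)⟩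
  · right
    intro R hR h1 h2
    -- Here the evenness of `q` enters: it makes the exponent `q ^ 2 - 1` odd.
    obtain ⟨n, hn⟩ : ∃ n, Fintype.card K ^ 2 - 1 = 2 * n + 1 := by
      have h1 : 1 ≤ Fintype.card K ^ 2 := Nat.one_le_pow _ _ Fintype.card_pos
      obtain ⟨n, hn⟩ := hq.pow_of_ne_zero (n := 2) two_ne_zero
      exact ⟨n - 1, by omega⟩
    rw [hn] at h
    have hmem : v ∈ Subtype.val '' R := by
      refine mem_of_odd_pow_eq_one (hsq u hu') (hsq v hv') h ⟨_, hR, rfl⟩ ?_ ?_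
      · rintro _ ⟨x, hx, rfl⟩
        exact ⟨_, h1 x hx, rfl⟩
      · rintro _ ⟨x, hx, rfl⟩
        exact ⟨_, h2 x hx, rfl⟩
    obtain ⟨x, hx, hxv⟩ := hmem
    exact (Subtype.ext hxv : x = ⟨v, hv⟩) ▸ hx

end TypeW

theorem lemma4p26 {K k : Type*} [Field K] [Fintype K] (hq : Even (Fintype.card K))
    [Field k] [Algebra K k] [IsAlgClosure K k] :
    ∃ O : ConjClasses (SpFin 2 K k),
      (∀ u : SpFin 2 K k, IsOfTypeW (u : Sp 2 k) ↔ u ∈ O.carrier) ∧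
      (∀ u : SpFin 2 K k, IsOfTypeW (u : Sp 2 k) →
        classesWithin (SpFin 2 K k) (u : Sp 2 k) = {O}) ∧
      IsCthulhu O.carrier := by
  have : CharP K 2 :=
    ringChar.of_eq (FiniteField.even_card_iff_char_two.mpr (Nat.even_iff.mp hq))
  have : CharP k 2 := charP_of_injective_algebraMap (algebraMap K k).injective 2
  have : IsAlgClosed k := IsAlgClosure.isAlgClosed K
  exact ⟨ConjClasses.mk (standardSpFin k K), isOfTypeW_iff_mem_carrier K,
    fun u hu => classesWithin_eq_of_isOfTypeW K hu, isCthulhu_carrier_standardSpFin hq⟩
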